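/- **Setting.** Let $\mathcal T$ be the set of isomorphism classes of finite non-planar rooted trees and $\mathcal H$ the free commutative unital $\mathbb Q$-algebra generated by $\mathcal T$. A rooted forest is a monomial in trees, that is, an element of the free commutative monoid $\mathcal F$ on $\mathcal T$; the forests form a $\mathbb Q$-basis of $\mathcal H$. Write $\mathbb I=1$ for the empty forest and $\bullet$ for the tree with one vertex. Let $B_+:\mathcal H\to\mathcal H$ be the $\mathbb Q$-linear map that sends a forest $t_1\cdots t_k$ to the tree obtained by joining the roots of $t_1,\dots,t_k$ to a new common root (so $B_+(\mathbb I)=\bullet$). Let $\Delta:\mathcal H\to\mathcal H\otimes\mathcal H$ be the algebra homomorphism with $\Delta(t)=t\otimes\mathbb I+(\mathrm{id}\otimes B_+)(\Delta(f))$ for every tree $t=B_+(f)$, $f\in\mathcal F$. Let $\mathfrak H=\mathbb Q\langle x,y\rangle$ be the noncommutative polynomial ring. The rooted tree maps $\tilde f=\rho(f)$ are given by the unique $\mathbb Q$-linear map $\rho:\mathcal H\to\mathrm{End}_{\mathbb Q}(\mathfrak H)$ such that $\tilde{\mathbb I}=\mathrm{id}$ and 1. $\tilde\bullet(x)=-\tilde\bullet(y)=xy$;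 2. for every forest $f\neq\mathbb I$, $\tilde f(x)=uy$ for some $u\in\mathfrak H$, and $\widetilde{B_+(f)}(x)=-\widetilde{B_+(f)}(y)=u(x+2y)y$; 3. $\widetilde{gh}(v)=\tilde g(\tilde h(v))$ for all forests $g,h$ and $v\in\{x,y\}$; 4. for every forest $f\neq\mathbb I$, all $w\in\mathfrak H$ and $v\in\{x,y\}$, $\tilde f(wv)=\sum\tilde f_1(w)\,\tilde f_2(v)$, where $\Delta(f)=\sum f_1\otimes f_2$. (Such a $\rho$ exists and is unique.) For $k\ge 0$ let $\lambda_k=B_+^k(\mathbb I)$; it is the ladder tree with $k$ vertices for $k\geq 1$, and $\lambda_0=\mathbb I$. For $m,n\ge1$ put $$f_{m,n}=\lambda_m\lambda_n-\sum_{\substack{0\le i\le m-1\\0\le j\le n-1}}B_+^{\,m-i+n-j-2}\bigl(\bullet\, B_+(\lambda_i\lambda_j)\bigr)+\sum_{\substack{0\le i\le m-1\\0\le j\le n-1\\(i,j)\ne(0,0)}}B_+^{\,m-i+n-j-1}\bigl(\bullet\,\lambda_i\lambda_j\bigr)\in\mathcal H .$$ **Theorem.** For all $m,n\ge 1$, $\rho(f_{m,n})=0$;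 that is, $\widetilde{f_{m,n}}=0$ as a linear map on $\mathfrak H$. -/

import Mathlib

noncomputable section

namespace RootedTreeMaps

open scoped TensorProduct

/-! Rooted trees and forests. -/

/-- Planar rooted trees: a root together with an ordered list of branches. -/
inductive PlanarTree : Type
  | node : List PlanarTree → PlanarTree

/-- Elementary identifications of planar trees: reordering the branches of the root, or
applying such an identification inside one branch. They generate isomorphism of the underlying
(non-planar) rooted trees. -/
inductive PlanarTree.Rel : PlanarTree → PlanarTree → Prop
  | perm {l₁ l₂ : List PlanarTree} (h : l₁.Perm l₂) : Rel (.node l₁) (.node l₂)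
  | branch {s t : PlanarTree} (l₁ l₂ : List PlanarTree) (h : Rel s t) :
      Rel (.node (l₁ ++ s :: l₂)) (.node (l₁ ++ t :: l₂))

/-- The set `𝓣` of isomorphism classes of (non-planar) finite rooted trees. -/
def RootedTree : Type := Quot PlanarTree.Rel

/-- Number of vertices of a planar tree. -/
def PlanarTree.deg : PlanarTree → ℕ
  | .node l => 1 + (l.map PlanarTree.deg).sum

instance : DecidableEq RootedTree := Classical.decEq _

namespace RootedTree

/-- The isomorphism class of a planar tree. -/
def mk (t : PlanarTree) : RootedTree := Quot.mk PlanarTree.Rel t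

/-- A planar representative of a rooted tree. -/
def out (t : RootedTree) : PlanarTree := Quot.out t

theorem mk_out (t : RootedTree) : mk t.out = t := Quot.out_eq t

theorem mk_sound {s t : PlanarTree} (h : PlanarTree.Rel s t) : mk s = mk t := Quot.sound h

/-- The number of vertices. -/
def deg : RootedTree → ℕ :=
  Quot.lift PlanarTree.deg (by
    intro s t h
    induction h with
    | perm h => simp only [PlanarTree.deg]; rw [(h.map _).sum_eq]
    | branch l₁ l₂ h ih => simp [PlanarTree.deg, ih])

/-- The multiset of branches at the root. -/
def branches : RootedTree → Multiset RootedTree :=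
  Quot.lift (fun t => match t with
    | .node l => (↑(l.map mk) : Multiset RootedTree)) (by
    intro s t h
    cases h with
    | perm h => exact Multiset.coe_eq_coe.2 (h.map _)
    | branch l₁ l₂ h => simp only [List.map_append, List.map_cons, mk_sound h])

/-- Join all trees of a forest to a new common root. -/
def graft (m : Multiset RootedTree) : RootedTree := mk (.node (m.toList.map out))

theorem mk_node_congr (l l' : List PlanarTree) (h : l.map mk = l'.map mk)
    (p : List PlanarTree) : mk (.node (p ++ l)) = mk (.node (p ++ l')) := by
  induction l generalizing l' p with
  | nil =>
    cases l' with
    | nil => rfl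
    | cons t l' => simp at h
  | cons s l ih =>
    cases l' with
    | nil => simp at h
    | cons t l' =>
      simp only [List.map_cons, List.cons.injEq] at h
      have h1 : mk (.node (p ++ s :: l)) = mk (.node (p ++ t :: l)) :=
        congrArg (Quot.lift (fun u => mk (.node (p ++ u :: l)))
          (fun a b hab => mk_sound (.branch p l hab))) h.1
      have h2 := ih l' h.2 (p ++ [t])
      simp only [List.append_assoc, List.singleton_append] at h2
      exact h1.trans h2

theorem map_mk_map_out (l : List RootedTree) : (l.map out).map mk = l := by
  induction l with
  | nil => rfl
  | cons a l ih => simp only [List.map_cons, mk_out, ih]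

theorem graft_mk (l : List PlanarTree) :
    graft (↑(l.map mk) : Multiset RootedTree) = mk (.node l) := by
  have key : ∀ q : List RootedTree, q.Perm (l.map mk) →
      mk (.node (q.map out)) = mk (.node l) := by
    intro q hq
    rw [mk_sound (.perm (hq.map out))]
    exact mk_node_congr _ _ (map_mk_map_out _) []
  exact key _ (Multiset.coe_eq_coe.1 (Multiset.coe_toList _))

theorem branches_graft (m : Multiset RootedTree) : (graft m).branches = m := by
  have h : (graft m).branches = (↑((m.toList.map out).map mk) : Multiset RootedTree) := rfl
  rw [h, map_mk_map_out, Multiset.coe_toList]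

theorem graft_branches (t : RootedTree) : graft t.branches = t := by
  induction t using Quot.ind with
  | mk t => cases t with | node l => exact graft_mk l

theorem deg_graft (m : Multiset RootedTree) : (graft m).deg = 1 + (m.map deg).sum := by
  have h : (graft m).deg = 1 + ((m.toList.map out).map PlanarTree.deg).sum := by
    change PlanarTree.deg _ = _
    rw [PlanarTree.deg]
  have h2 : ∀ l : List RootedTree, (l.map out).map PlanarTree.deg = l.map deg := by
    intro l
    induction l with
    | nil => rfl
    | cons a l ih =>
      have h3 : deg a = a.out.deg := by
        conv_lhs => rw [← mk_out a]
        rfl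
      simp only [List.map_cons, h3, ih]
  rw [h, h2]
  conv_rhs => rw [← Multiset.coe_toList m]
  simp only [Multiset.map_coe, Multiset.sum_coe]

theorem deg_lt_of_mem_branches {s t : RootedTree} (h : s ∈ t.branches) : s.deg < t.deg := by
  rw [← graft_branches t, deg_graft]
  have := Multiset.le_sum_of_mem (Multiset.mem_map_of_mem deg h)
  omega

end RootedTree

/-- The commutative `ℚ`-algebra `𝓗` freely generated by the rooted trees. -/
abbrev HopfTrees : Type := MvPolynomial RootedTree ℚ

/-- The rooted forest with the given multiset of components, as an element of `𝓗`. The empty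
forest is the unit. -/
def forest (m : Multiset RootedTree) : HopfTrees := (m.map MvPolynomial.X).prod

/-- The grafting operator `B₊`: the linear map sending every forest to the tree obtained by
joining its components to a new common root. -/
def graftOp : HopfTrees →ₗ[ℚ] HopfTrees :=
  (MvPolynomial.basisMonomials RootedTree ℚ).constr ℚ
    (fun s => MvPolynomial.X (RootedTree.graft (Finsupp.toMultiset s)))

/-- The coproduct of a rooted tree `t = B₊(f)`, namely
`Δ(t) = t ⊗ 𝕀 + (id ⊗ B₊)(Δ(f))`, where `Δ(f)` is the product over the components of `f`. -/
def coproductTree (t : RootedTree) : HopfTrees ⊗[ℚ] HopfTrees :=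
  MvPolynomial.X t ⊗ₜ[ℚ] 1 +
    graftOp.lTensor HopfTrees (t.branches.attach.map (fun s => coproductTree s.1)).prod
termination_by t.deg
decreasing_by exact RootedTree.deg_lt_of_mem_branches s.2

/-- The coproduct `Δ : 𝓗 → 𝓗 ⊗ 𝓗`, an algebra homomorphism. -/
def coproduct : HopfTrees →ₐ[ℚ] HopfTrees ⊗[ℚ] HopfTrees :=
  MvPolynomial.aeval coproductTree

theorem forest_eq_monomial (m : Multiset RootedTree) :
    forest m = MvPolynomial.monomial (Multiset.toFinsupp m) 1 := by
  induction m using Multiset.induction_on with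
  | empty => simp [forest]
  | cons a m ih =>
    rw [forest] at ih ⊢
    rw [Multiset.map_cons, Multiset.prod_cons, ih, ← Multiset.singleton_add, map_add,
      Multiset.toFinsupp_singleton, MvPolynomial.X, MvPolynomial.monomial_mul, one_mul]

theorem graftOp_forest (m : Multiset RootedTree) :
    graftOp (forest m) = MvPolynomial.X (RootedTree.graft m) := by
  have h := (MvPolynomial.basisMonomials RootedTree ℚ).constr_basis ℚ
    (fun s => (MvPolynomial.X (RootedTree.graft (Finsupp.toMultiset s)) : HopfTrees))
    (Multiset.toFinsupp m)
  rw [MvPolynomial.coe_basisMonomials, Multiset.toFinsupp_toMultiset] at h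
  rw [forest_eq_monomial]
  exact h

/-- Forests span `𝓗`. -/
theorem forest_induction {P : HopfTrees → Prop} (hf : ∀ m, P (forest m))
    (hadd : ∀ a b, P a → P b → P (a + b)) (hsmul : ∀ (c : ℚ) a, P a → P (c • a))
    (f : HopfTrees) : P f := by
  induction f using MvPolynomial.induction_on' with
  | monomial u a =>
    have h := hsmul a _ (hf (Finsupp.toMultiset u))
    rwa [forest_eq_monomial, Finsupp.toMultiset_toFinsupp, MvPolynomial.smul_monomial,
      smul_eq_mul, mul_one] at h
  | add p q hp hq => exact hadd _ _ hp hq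

theorem coproduct_X_graft (m : Multiset RootedTree) :
    coproduct (MvPolynomial.X (RootedTree.graft m)) =
      MvPolynomial.X (RootedTree.graft m) ⊗ₜ[ℚ] 1 +
        graftOp.lTensor HopfTrees (coproduct (forest m)) := by
  rw [coproduct, MvPolynomial.aeval_X, coproductTree]
  congr 3
  rw [RootedTree.branches_graft, forest, map_multiset_prod, Multiset.map_map]
  conv_rhs => rw [← Multiset.attach_map_val m, Multiset.map_map]
  simp


/-! Words and the defining conditions of rooted tree maps. -/

/-- The two letters. -/
inductive Letter : Type
  | x : Letter
  | y : Letter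

/-- The noncommutative polynomial ring `𝔥 = ℚ⟨x, y⟩`. -/
abbrev Words : Type := FreeAlgebra ℚ Letter

/-- The letter `x`. -/
def X : Words := FreeAlgebra.ι ℚ Letter.x

/-- The letter `y`. -/
def Y : Words := FreeAlgebra.ι ℚ Letter.y

/-- The tree with one vertex. -/
def dot : HopfTrees := forest {RootedTree.graft 0}

/-- For a linear map `ρ : 𝓗 → End(𝔥)`, `f ↦ f̃`, and `∑ f₁ ⊗ f₂` in `𝓗 ⊗ 𝓗`, the endomorphism
`∑ f̃₁ ⊗ f̃₂` of `𝔥 ⊗ 𝔥`. -/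
def tensorAct (ρ : HopfTrees →ₗ[ℚ] Module.End ℚ Words) :
    HopfTrees ⊗[ℚ] HopfTrees →ₗ[ℚ] Module.End ℚ (Words ⊗[ℚ] Words) :=
  TensorProduct.homTensorHomMap (RingHom.id ℚ) Words Words Words Words ∘ₗ TensorProduct.map ρ ρ

/-- The defining conditions of the assignment `f ↦ f̃ = ρ f` of rooted tree maps. -/
structure IsRootedTreeMaps (ρ : HopfTrees →ₗ[ℚ] Module.End ℚ Words) : Prop where
  /-- The empty forest acts as the identity. -/
  empty : ρ (forest 0) = LinearMap.id
  /-- The values of the one-vertex tree on the letters. -/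
  dot_x : ρ dot X = X * Y
  dot_y : ρ dot Y = -(X * Y)
  /-- For a nonempty forest `f` one has `f̃(x) = u y` for some (necessarily unique) `u`, and the
  tree `B₊(f)` sends `x` to `u (x + 2 y) y` and `y` to the opposite. -/
  graft : ∀ m : Multiset RootedTree, m ≠ 0 → ∃ u : Words,
    ρ (forest m) X = u * Y ∧
    ρ (graftOp (forest m)) X = u * (X + 2 * Y) * Y ∧
    ρ (graftOp (forest m)) Y = -(u * (X + 2 * Y) * Y)
  /-- Products of forests act on the letters by composition. -/
  mul_x : ∀ g h : Multiset RootedTree,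
    ρ (forest g * forest h) X = ρ (forest g) (ρ (forest h) X)
  mul_y : ∀ g h : Multiset RootedTree,
    ρ (forest g * forest h) Y = ρ (forest g) (ρ (forest h) Y)
  /-- On `w v` with `v` a letter, `f̃` acts through the coproduct of `f`. -/
  word_x : ∀ (m : Multiset RootedTree) (w : Words), m ≠ 0 →
    ρ (forest m) (w * X) =
      LinearMap.mul' ℚ Words (tensorAct ρ (coproduct (forest m)) (w ⊗ₜ[ℚ] X))
  word_y : ∀ (m : Multiset RootedTree) (w : Words), m ≠ 0 →
    ρ (forest m) (w * Y) =
      LinearMap.mul' ℚ Words (tensorAct ρ (coproduct (forest m)) (w ⊗ₜ[ℚ] Y))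

/-- The ladder tree with `k` vertices; for `k = 0` it is the empty forest. -/
def ladder (k : ℕ) : HopfTrees := graftOp^[k] 1

/-- The element `f_{m,n}` of `𝓗`. With `λ k` the ladder with `k` vertices, it is
`λ m λ n - ∑ B₊^(m-i+n-j-2) (• B₊(λ i λ j)) + ∑ B₊^(m-i+n-j-1) (• λ i λ j)`, the sums over
`0 ≤ i ≤ m - 1` and `0 ≤ j ≤ n - 1`, with `(i, j) = (0, 0)` left out in the second one. -/
def relationElement (m n : ℕ) : HopfTrees :=
  ladder m * ladder n
    - ∑ i ∈ Finset.range m, ∑ j ∈ Finset.range n,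
        graftOp^[(m - i) + (n - j) - 2] (dot * graftOp (ladder i * ladder j))
    + ∑ p ∈ (Finset.range m ×ˢ Finset.range n).filter (fun p => p ≠ (0, 0)),
        graftOp^[(m - p.1) + (n - p.2) - 1] (dot * ladder p.1 * ladder p.2)

/-! The remainder shows that exactly one assignment satisfies the defining conditions, and then
names it. -/

theorem tensorAct_tmul (ρ : HopfTrees →ₗ[ℚ] Module.End ℚ Words) (a b : HopfTrees)
    (v w : Words) :
    LinearMap.mul' ℚ Words (tensorAct ρ (a ⊗ₜ[ℚ] b) (v ⊗ₜ[ℚ] w)) = ρ a v * ρ b w := by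
  simp [tensorAct]

/-- The letter `z = x + y`. -/
def Z : Words := X + Y

/-- A linear subspace containing `1` and stable under right multiplication by `z` and `y`. -/
theorem right_induction {P : Words → Prop} (h1 : P 1) (hadd : ∀ a b, P a → P b → P (a + b))
    (hsmul : ∀ (c : ℚ) a, P a → P (c • a)) (hz : ∀ a, P a → P (a * Z))
    (hy : ∀ a, P a → P (a * Y)) (a : Words) : P a := by
  suffices h : ∀ s, P s → P (s * a) by simpa using h 1 h1
  induction a using FreeAlgebra.induction with
  | grade0 r => intro s hs; rw [← Algebra.commutes, ← Algebra.smul_def]; exact hsmul _ _ hs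
  | grade1 l =>
    intro s hs
    cases l with
    | x =>
      have e : s * FreeAlgebra.ι ℚ Letter.x = s * Z + (-1 : ℚ) • (s * Y) := by
        simp [Z, X, mul_add]
      rw [e]; exact hadd _ _ (hz _ hs) (hsmul _ _ (hy _ hs))
    | y => exact hy _ hs
  | mul a b ha hb => intro s hs; rw [← mul_assoc]; exact hb _ (ha _ hs)
  | add a b ha hb => intro s hs; rw [mul_add]; exact hadd _ _ (ha _ hs) (hb _ hs)

theorem left_induction {P : Words → Prop} (h1 : P 1) (hadd : ∀ a b, P a → P b → P (a + b))
    (hsmul : ∀ (c : ℚ) a, P a → P (c • a)) (hz : ∀ a, P a → P (Z * a))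
    (hx : ∀ a, P a → P (X * a)) (a : Words) : P a := by
  suffices h : ∀ s, P s → P (a * s) by simpa using h 1 h1
  induction a using FreeAlgebra.induction with
  | grade0 r => intro s hs; rw [← Algebra.smul_def]; exact hsmul _ _ hs
  | grade1 l =>
    intro s hs
    cases l with
    | y =>
      have e : FreeAlgebra.ι ℚ Letter.y * s = Z * s + (-1 : ℚ) • (X * s) := by
        simp [Z, Y, add_mul]
      rw [e]; exact hadd _ _ (hz _ hs) (hsmul _ _ (hx _ hs))
    | x => exact hx _ hs
  | mul a b ha hb => intro s hs; rw [mul_assoc]; exact ha _ (hb _ hs)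
  | add a b ha hb => intro s hs; rw [add_mul]; exact hadd _ _ (ha _ hs) (hb _ hs)

section Fold

variable {W : Type} [AddCommGroup W] [Module ℚ W]

/-- The linear map determined by its value at `1` and its recursions under right multiplication
by `z` and by `y`. -/
def foldR (sz sy : Module.End ℚ W) (w₀ : W) : Words →ₗ[ℚ] W :=
  LinearMap.applyₗ w₀ ∘ₗ (MulOpposite.opLinearEquiv ℚ).symm.toLinearMap ∘ₗ
    (FreeAlgebra.lift ℚ (fun l : Letter => match l with
      | .x => MulOpposite.op (sz - sy)
      | .y => MulOpposite.op sy) : Words →ₐ[ℚ] (Module.End ℚ W)ᵐᵒᵖ).toLinearMap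

theorem foldR_one (sz sy : Module.End ℚ W) (w₀ : W) : foldR sz sy w₀ 1 = w₀ := by
  simp [foldR]

theorem foldR_mul_Y (sz sy : Module.End ℚ W) (w₀ : W) (a : Words) :
    foldR sz sy w₀ (a * Y) = sy (foldR sz sy w₀ a) := by
  simp [foldR, Y]

theorem foldR_mul_Z (sz sy : Module.End ℚ W) (w₀ : W) (a : Words) :
    foldR sz sy w₀ (a * Z) = sz (foldR sz sy w₀ a) := by
  simp [foldR, Y, X, Z, mul_add]

/-- The linear map determined by its value at `1` and its recursions under left multiplication
by `z` and by `x`. -/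
def foldL (sz sx : Module.End ℚ W) (w₀ : W) : Words →ₗ[ℚ] W :=
  LinearMap.applyₗ w₀ ∘ₗ
    (FreeAlgebra.lift ℚ (fun l : Letter => match l with
      | .x => sx
      | .y => sz - sx) : Words →ₐ[ℚ] Module.End ℚ W).toLinearMap

theorem foldL_one (sz sx : Module.End ℚ W) (w₀ : W) : foldL sz sx w₀ 1 = w₀ := by
  simp [foldL]

theorem foldL_X_mul (sz sx : Module.End ℚ W) (w₀ : W) (a : Words) :
    foldL sz sx w₀ (X * a) = sx (foldL sz sx w₀ a) := by
  simp [foldL, X]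

theorem foldL_Z_mul (sz sx : Module.End ℚ W) (w₀ : W) (a : Words) :
    foldL sz sx w₀ (Z * a) = sz (foldL sz sx w₀ a) := by
  simp [foldL, Y, X, Z, add_mul]

end Fold

/-- Right multiplication. -/
abbrev rmul (w : Words) : Words →ₗ[ℚ] Words := LinearMap.mulRight ℚ w

/-- A recursion step for `yOp`. -/
def stepY : Module.End ℚ (Words × (Module.End ℚ Words →ₗ[ℚ] Words)) where
  toFun s := (s.1 * Y, rmul Y ∘ₗ LinearMap.applyₗ (s.1 * Y) + rmul Y ∘ₗ s.2 -
    rmul (Z * Y) ∘ₗ LinearMap.applyₗ s.1)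
  map_add' s t := by
    refine Prod.ext (by simp [add_mul]) ?_
    ext P
    simp [add_mul]
    abel
  map_smul' c s := by
    refine Prod.ext (by simp) ?_
    ext P
    simp [smul_sub]

/-- A recursion step for `yOp`. -/
def stepZ : Module.End ℚ (Words × (Module.End ℚ Words →ₗ[ℚ] Words)) where
  toFun s := (s.1 * Z, rmul Z ∘ₗ s.2)
  map_add' s t := by
    refine Prod.ext (by simp [add_mul]) ?_
    ext P
    simp [add_mul]
  map_smul' c s := by
    refine Prod.ext (by simp) ?_
    ext P
    simp

/-- State of the recursion for `yOp`. -/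
def yState : Words →ₗ[ℚ] Words × (Module.End ℚ Words →ₗ[ℚ] Words) :=
  foldR stepZ stepY (1, rmul Y ∘ₗ LinearMap.applyₗ 1)

theorem yState_fst (a : Words) : (yState a).1 = a := by
  induction a using right_induction with
  | h1 => simp [yState, foldR_one]
  | hadd a b ha hb => simp [ha, hb]
  | hsmul c a ha => simp [ha]
  | hz a ha => rw [yState, foldR_mul_Z, ← yState]; simp [stepZ, ha]
  | hy a ha => rw [yState, foldR_mul_Y, ← yState]; simp [stepY, ha]

/-- If `P` is the multiplication by `v` then `yOp P` is the multiplication by `v y`. -/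
def yOp : Module.End ℚ (Module.End ℚ Words) := (LinearMap.snd ℚ _ _ ∘ₗ yState).flip

theorem yOp_one (P : Module.End ℚ Words) : yOp P 1 = P 1 * Y := by
  simp [yOp, yState, foldR_one]

theorem yOp_mul_Z (P : Module.End ℚ Words) (w : Words) : yOp P (w * Z) = yOp P w * Z := by
  simp only [yOp, LinearMap.flip_apply, LinearMap.comp_apply, LinearMap.snd_apply]
  conv_lhs => rw [yState, foldR_mul_Z, ← yState]
  simp [stepZ]

theorem yOp_mul_Y (P : Module.End ℚ Words) (w : Words) :
    yOp P (w * Y) = P (w * Y) * Y + yOp P w * Y - P w * Z * Y := by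
  simp only [yOp, LinearMap.flip_apply, LinearMap.comp_apply, LinearMap.snd_apply]
  conv_lhs => rw [yState, foldR_mul_Y, ← yState]
  simp [stepY, yState_fst, mul_assoc]

/-- An analogue of the harmonic product on words. -/
def dia : Words →ₗ[ℚ] Words →ₗ[ℚ] Words :=
  foldR (W := Module.End ℚ Words) (LinearMap.mulLeft ℚ (rmul Z : Module.End ℚ Words)) yOp
    LinearMap.id

theorem dia_one_left (b : Words) : dia 1 b = b := by simp [dia, foldR_one]

theorem dia_Z_left (a b : Words) : dia (a * Z) b = dia a b * Z := by simp [dia, foldR_mul_Z]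

theorem dia_Y_one (a : Words) : dia (a * Y) 1 = dia a 1 * Y := by
  simp [dia, foldR_mul_Y, yOp_one]

theorem dia_Y_Z (a b : Words) : dia (a * Y) (b * Z) = dia (a * Y) b * Z := by
  simp [dia, foldR_mul_Y, yOp_mul_Z]

theorem dia_Y_Y (a b : Words) : dia (a * Y) (b * Y) =
    dia a (b * Y) * Y + dia (a * Y) b * Y - dia a b * Z * Y := by
  simp [dia, foldR_mul_Y, yOp_mul_Y]

theorem dia_one_right (a : Words) : dia a 1 = a := by
  induction a using right_induction with
  | h1 => exact dia_one_left 1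
  | hadd a b ha hb => simp [ha, hb]
  | hsmul c a ha => simp [ha]
  | hz a ha => rw [dia_Z_left, ha]
  | hy a ha => rw [dia_Y_one, ha]

theorem dia_Z_right (a b : Words) : dia a (b * Z) = dia a b * Z := by
  induction a using right_induction with
  | h1 => simp [dia_one_left]
  | hadd a b ha hb => simp [ha, hb, add_mul]
  | hsmul c a ha => simp [ha]
  | hz a ha => rw [dia_Z_left, dia_Z_left, ha]
  | hy a ha => rw [dia_Y_Z]

theorem X_eq : X = Z - Y := by simp [Z]

theorem dia_Y_X (a b : Words) : dia (a * Y) (b * X) = dia a (b * X) * Y + dia (a * Y) b * X := by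
  simp only [X_eq, mul_sub, map_sub, dia_Y_Y, dia_Z_right, sub_mul]
  abel

theorem dia_comm (a b : Words) : dia a b = dia b a := by
  induction a using right_induction generalizing b with
  | h1 => rw [dia_one_left, dia_one_right]
  | hadd a b ha hb => simp [ha, hb]
  | hsmul c a ha => simp [ha]
  | hz a ha => rw [dia_Z_left, dia_Z_right, ha]
  | hy a ha =>
    induction b using right_induction with
    | h1 => rw [dia_one_left, dia_one_right]
    | hadd a b ha hb => simp [ha, hb]
    | hsmul c a ha => simp [ha]
    | hz b hb => rw [dia_Z_left, dia_Z_right, hb]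
    | hy b hb => rw [dia_Y_Y, dia_Y_Y, ha, ha, hb]; abel

theorem dia_assoc (a b c : Words) : dia (dia a b) c = dia a (dia b c) := by
  induction a using right_induction generalizing b c with
  | h1 => rw [dia_one_left, dia_one_left]
  | hadd a b ha hb => simp [ha, hb]
  | hsmul c a ha => simp [ha]
  | hz a ha => rw [dia_Z_left, dia_Z_left, dia_Z_left, ha]
  | hy a ha =>
    induction b using right_induction generalizing c with
    | h1 => rw [dia_one_left, dia_one_right]
    | hadd a b ha hb => simp [ha, hb]
    | hsmul c a ha => simp [ha]
    | hz b hb => rw [dia_Z_right, dia_Z_left, dia_Z_left, dia_Z_right, hb]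
    | hy b hb =>
      induction c using right_induction with
      | h1 => rw [dia_one_right, dia_one_right]
      | hadd a b ha hb => simp [ha, hb]
      | hsmul c a ha => simp [ha]
      | hz c hc => rw [dia_Z_right, dia_Z_right, dia_Z_right, hc]
      | hy c hc =>
        have e1 : dia (dia (a * Y) (b * Y)) (c * Y) =
            dia (dia a (b * Y)) (c * Y) * Y + dia (dia (a * Y) b) (c * Y) * Y
              - dia (dia a b) (c * Y) * Z * Y + dia (dia (a * Y) (b * Y)) c * Y
              - (dia (dia a (b * Y)) c + dia (dia (a * Y) b) c - dia (dia a b) c * Z)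
                * Z * Y := by
          have h : dia (a * Y) (b * Y) =
            (dia a (b * Y) + dia (a * Y) b - dia a b * Z) * Y := by
            rw [dia_Y_Y, sub_mul, add_mul]
          rw [h, dia_Y_Y]
          simp only [map_sub, map_add, LinearMap.sub_apply, LinearMap.add_apply, dia_Z_left,
            sub_mul, add_mul]
        have e2 : dia (a * Y) (dia (b * Y) (c * Y)) =
            dia a (dia (b * Y) (c * Y)) * Y + dia (a * Y) (dia b (c * Y)) * Y
              + dia (a * Y) (dia (b * Y) c) * Y - dia (a * Y) (dia b c) * Z * Y
              - (dia a (dia b (c * Y)) + dia a (dia (b * Y) c) - dia a (dia b c) * Z)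
                * Z * Y := by
          have h : dia (b * Y) (c * Y) =
            (dia b (c * Y) + dia (b * Y) c - dia b c * Z) * Y := by
            rw [dia_Y_Y, sub_mul, add_mul]
          rw [h, dia_Y_Y]
          simp only [map_sub, map_add, dia_Z_right, sub_mul, add_mul]
          abel
        rw [e1, e2]
        simp only [ha, hb, hc, sub_mul, add_mul]
        abel

/-- The space `𝔥` with the product `dia`. -/
def DiaAlg : Type := Words

instance : AddCommGroup DiaAlg := inferInstanceAs (AddCommGroup Words)

instance : Module ℚ DiaAlg := inferInstanceAs (Module ℚ Words)

instance : CommRing DiaAlg :=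
  { (inferInstance : AddCommGroup DiaAlg) with
    mul := fun a b => dia a b
    one := (1 : Words)
    mul_assoc := dia_assoc
    mul_comm := dia_comm
    one_mul := dia_one_left
    mul_one := dia_one_right
    left_distrib := fun a b c => (dia a).map_add b c
    right_distrib := fun a b c => LinearMap.map_add₂ dia a b c
    zero_mul := fun a => LinearMap.map_zero₂ dia a
    mul_zero := fun a => (dia a).map_zero }

instance : Algebra ℚ DiaAlg :=
  Algebra.ofModule (fun c a b => LinearMap.map_smul₂ dia c a b) (fun c a b => (dia a).map_smul c b)

/-- The identity map from the space with product `dia` to `𝔥`. -/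
def toWords : DiaAlg →ₗ[ℚ] Words := LinearMap.id

theorem toWords_one : toWords 1 = 1 := rfl

theorem toWords_mul (a b : DiaAlg) : toWords (a * b) = dia (toWords a) (toWords b) := rfl

/-- The inverse of `toWords`. -/
def ofWords : Words →ₗ[ℚ] DiaAlg := LinearMap.id

theorem toWords_ofWords (a : Words) : toWords (ofWords a) = a := rfl

theorem ofWords_toWords (a : DiaAlg) : ofWords (toWords a) = a := rfl

/-- A recursion step for `rop`. -/
def ropStep : Module.End ℚ (Words × Words) where
  toFun s := (s.1 * Y, s.1 * (Z + Y) * Y)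
  map_add' s t := by simp [add_mul]
  map_smul' c s := by simp

/-- A recursion step for `rop`. -/
def ropStepZ : Module.End ℚ (Words × Words) where
  toFun s := (s.1 * Z, 0)
  map_add' s t := by simp [add_mul]
  map_smul' c s := by simp

/-- State of the recursion for `rop`. -/
def ropState : Words →ₗ[ℚ] Words × Words := foldR ropStepZ ropStep (1, Y)

theorem ropState_fst (a : Words) : (ropState a).1 = a := by
  induction a using right_induction with
  | h1 => simp [ropState, foldR_one]
  | hadd a b ha hb => simp [ha, hb]
  | hsmul c a ha => simp [ha]
  | hz a ha => rw [ropState, foldR_mul_Z, ← ropState]; simp [ropStepZ, ha]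
  | hy a ha => rw [ropState, foldR_mul_Y, ← ropState]; simp [ropStep, ha]

/-- The linear map sending `1` to `y` and `u y` to `u (x + 2 y) y`. -/
def rop : Words →ₗ[ℚ] Words := LinearMap.snd ℚ _ _ ∘ₗ ropState

theorem rop_one : rop 1 = Y := by simp [rop, ropState, foldR_one]

theorem rop_mul_Y (u : Words) : rop (u * Y) = u * (Z + Y) * Y := by
  simp only [rop, LinearMap.comp_apply, LinearMap.snd_apply]
  rw [ropState, foldR_mul_Y, ← ropState]
  simp [ropStep, ropState_fst]

theorem rop_mul_Z (u : Words) : rop (u * Z) = 0 := by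
  simp only [rop, LinearMap.comp_apply, LinearMap.snd_apply]
  rw [ropState, foldR_mul_Z, ← ropState]
  simp [ropStepZ]

/-- The values of `rop` end with `y`. -/
theorem rop_ends (a : Words) : ∃ u, rop a = u * Y := by
  induction a using right_induction with
  | h1 => exact ⟨1, by simp [rop_one]⟩
  | hadd a b ha hb =>
    obtain ⟨u, hu⟩ := ha
    obtain ⟨v, hv⟩ := hb
    exact ⟨u + v, by rw [map_add, hu, hv, add_mul]⟩
  | hsmul c a ha =>
    obtain ⟨u, hu⟩ := ha
    exact ⟨c • u, by rw [map_smul, hu, smul_mul_assoc]⟩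
  | hz a ha => exact ⟨0, by simp [rop_mul_Z]⟩
  | hy a ha => exact ⟨_, rop_mul_Y a⟩

/-- The constant term. -/
def const : Words →ₐ[ℚ] ℚ := FreeAlgebra.lift ℚ (fun _ => 0)

theorem const_X : const X = 0 := by simp [const, X]

theorem const_Y : const Y = 0 := by simp [const, Y]

theorem const_Z : const Z = 0 := by rw [Z, map_add, const_X, const_Y, add_zero]

theorem const_dia (a b : Words) : const (dia a b) = const a * const b := by
  induction a using right_induction generalizing b with
  | h1 => simp [dia_one_left]
  | hadd a b ha hb => simp [ha, hb, add_mul]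
  | hsmul c a ha => simp [ha, mul_assoc]
  | hz a ha => simp [dia_Z_left, const_Z]
  | hy a ha =>
    clear ha
    induction b using right_induction with
    | h1 => simp [dia_one_right]
    | hadd b c hb hc => simp only [map_add, hb, hc, mul_add]
    | hsmul c b hb => simp only [map_smul, hb, mul_smul_comm]
    | hz b hb => simp [dia_Z_right, const_Z]
    | hy b hb => simp [dia_Y_Y, const_Y]

/-- A recursion step for `thetaState`. -/
def thetaStepX : Module.End ℚ (Words × (Words →ₗ[ℚ] Words)) where
  toFun s := (X * s.1, LinearMap.mulLeft ℚ X ∘ₗ dia.flip s.1)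
  map_add' s t := by
    refine Prod.ext (by simp [mul_add]) ?_
    ext1 P
    simp [mul_add]
  map_smul' c s := by
    refine Prod.ext (by simp) ?_
    ext1 P
    simp

/-- A recursion step for `thetaState`. -/
def thetaStepZ : Module.End ℚ (Words × (Words →ₗ[ℚ] Words)) where
  toFun s := (Z * s.1, LinearMap.mulLeft ℚ Z ∘ₗ s.2)
  map_add' s t := by
    refine Prod.ext (by simp [mul_add]) ?_
    ext1 P
    simp [mul_add]
  map_smul' c s := by
    refine Prod.ext (by simp) ?_
    ext1 P
    simp

/-- State of the recursion for `theta`. -/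
def thetaState : Words →ₗ[ℚ] Words × (Words →ₗ[ℚ] Words) :=
  foldL thetaStepZ thetaStepX (1, (Algebra.linearMap ℚ Words) ∘ₗ const.toLinearMap)

theorem thetaState_fst (a : Words) : (thetaState a).1 = a := by
  induction a using left_induction with
  | h1 => simp [thetaState, foldL_one]
  | hadd a b ha hb => simp [ha, hb]
  | hsmul c a ha => simp [ha]
  | hz a ha => rw [thetaState, foldL_Z_mul, ← thetaState]; simp [thetaStepZ, ha]
  | hx a ha => rw [thetaState, foldL_X_mul, ← thetaState]; simp [thetaStepX, ha]

/-- The linear map `theta F` sends `1` to the constant term of `F`, it commutes with left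
multiplication by `z`, and it sends `x w` to `x` times the `dia`-product of `F` and `w`. -/
def theta : Words →ₗ[ℚ] Module.End ℚ Words := (LinearMap.snd ℚ _ _ ∘ₗ thetaState).flip

theorem theta_one_right (F : Words) : theta F 1 = algebraMap ℚ Words (const F) := by
  simp [theta, thetaState, foldL_one]

theorem theta_Z_mul (F w : Words) : theta F (Z * w) = Z * theta F w := by
  simp only [theta, LinearMap.flip_apply, LinearMap.comp_apply, LinearMap.snd_apply]
  conv_lhs => rw [thetaState, foldL_Z_mul, ← thetaState]
  simp [thetaStepZ]

theorem theta_X_mul (F w : Words) : theta F (X * w) = X * dia F w := by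
  simp only [theta, LinearMap.flip_apply, LinearMap.comp_apply, LinearMap.snd_apply]
  conv_lhs => rw [thetaState, foldL_X_mul, ← thetaState]
  simp [thetaStepX, thetaState_fst]

theorem theta_X (F : Words) : theta F X = X * F := by
  have h := theta_X_mul F 1
  rwa [mul_one, dia_one_right] at h

theorem theta_Y {F : Words} (hF : const F = 0) : theta F Y = -(X * F) := by
  have h := theta_Z_mul F 1
  rw [theta_one_right, hF, map_zero, mul_zero, mul_one, Z, map_add, theta_X] at h
  exact eq_neg_of_add_eq_zero_right h

theorem theta_one_left : theta 1 = LinearMap.id := by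
  ext1 w
  induction w using left_induction with
  | h1 => simp [theta_one_right]
  | hadd a b ha hb => simp_all
  | hsmul c a ha => simp_all
  | hz a ha => rw [theta_Z_mul, ha]; rfl
  | hx a ha => rw [theta_X_mul, dia_one_left]; rfl

theorem theta_dia (F G : Words) : theta (dia F G) = theta F * theta G := by
  ext1 w
  induction w using left_induction with
  | h1 =>
    simp only [Module.End.mul_apply, theta_one_right, const_dia]
    rw [Algebra.algebraMap_eq_smul_one (const G), map_smul, theta_one_right, map_mul, Algebra.smul_def,
      Algebra.commutes]
  | hadd a b ha hb => simp_all
  | hsmul c a ha => simp_all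
  | hz a ha => rw [theta_Z_mul, ha]; simp [theta_Z_mul]
  | hx a ha => rw [theta_X_mul, Module.End.mul_apply, theta_X_mul, theta_X_mul, dia_assoc]

theorem theta_mul_Z (F w : Words) : theta F (w * Z) = theta F w * Z := by
  induction w using left_induction with
  | h1 =>
    have h := theta_Z_mul F 1
    rw [mul_one] at h
    rw [one_mul, h, theta_one_right, Algebra.commutes]
  | hadd a b ha hb => simp [add_mul, ha, hb]
  | hsmul c a ha => simp [ha]
  | hz a ha => rw [mul_assoc, theta_Z_mul, theta_Z_mul, ha, mul_assoc]
  | hx a ha => rw [mul_assoc, theta_X_mul, theta_X_mul, dia_Z_right, mul_assoc]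

/-- The words `c + u y`. -/
def EndsY (F : Words) : Prop := ∃ (c : ℚ) (u : Words), F = algebraMap ℚ Words c + u * Y

theorem dia_Y_Y_ends (a b : Words) : ∃ u, dia (a * Y) (b * Y) = u * Y :=
  ⟨_, by rw [dia_Y_Y, ← add_mul, ← sub_mul]⟩

theorem endsY_dia {F G : Words} (hF : EndsY F) (hG : EndsY G) : EndsY (dia F G) := by
  obtain ⟨c, u, rfl⟩ := hF
  obtain ⟨d, v, rfl⟩ := hG
  obtain ⟨w, hw⟩ := dia_Y_Y_ends u v
  refine ⟨c * d, c • v + d • u + w, ?_⟩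
  simp only [Algebra.algebraMap_eq_smul_one, map_add, LinearMap.add_apply, map_smul,
    LinearMap.smul_apply, dia_one_left, dia_one_right, hw, add_mul, smul_mul_assoc, smul_add,
    smul_smul]
  rw [mul_comm c d]
  abel

/-- The difference `F̃(v x) - F̃(v) x` ends with `y`. -/
theorem theta_diff_ends {F : Words} (hF : EndsY F) (v : Words) :
    ∃ u, theta F (v * X) - theta F v * X = u * Y := by
  obtain ⟨c, p, rfl⟩ := hF
  have h : ∃ u, theta (p * Y) (v * X) - theta (p * Y) v * X = u * Y := by
    induction v using left_induction with
    | h1 =>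
      refine ⟨X * p, ?_⟩
      rw [one_mul, theta_X, theta_one_right, map_mul, const_Y, mul_zero, map_zero, zero_mul,
        sub_zero, mul_assoc]
    | hadd a b ha hb =>
      obtain ⟨u, hu⟩ := ha
      obtain ⟨v, hv⟩ := hb
      refine ⟨u + v, ?_⟩
      rw [add_mul u, ← hu, ← hv, add_mul, map_add, map_add, add_mul]
      abel
    | hsmul c a ha =>
      obtain ⟨u, hu⟩ := ha
      exact ⟨c • u, by rw [smul_mul_assoc c u, ← hu]; simp [smul_sub]⟩
    | hz a ha =>
      obtain ⟨u, hu⟩ := ha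
      exact ⟨Z * u, by rw [mul_assoc, theta_Z_mul, theta_Z_mul, mul_assoc, mul_assoc, ← hu, mul_sub]⟩
    | hx a ha =>
      refine ⟨X * dia p (a * X), ?_⟩
      rw [mul_assoc, theta_X_mul, theta_X_mul, dia_Y_X]
      noncomm_ring
  obtain ⟨u, hu⟩ := h
  refine ⟨u, ?_⟩
  rw [← hu, Algebra.algebraMap_eq_smul_one]
  simp [theta_one_left, add_mul]

/-- The key recursion for `theta (rop F)`. -/
theorem theta_rop {F : Words} (hF : EndsY F) (v : Words) :
    theta (rop F) (v * X) = theta (rop F) v * X + rop (theta F (v * X) - theta F v * X) +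
      theta F v * X * Y := by
  obtain ⟨c, p, rfl⟩ := hF
  have h1 : ∀ v, theta Y (v * X) = theta Y v * X + v * X * Y := by
    intro v
    induction v using left_induction with
    | h1 => rw [one_mul, theta_X, theta_one_right, const_Y]; simp
    | hadd a b ha hb => simp only [add_mul, map_add, ha, hb]; abel
    | hsmul c a ha => simp [ha]
    | hz a ha => rw [mul_assoc, theta_Z_mul, theta_Z_mul, ha]; noncomm_ring
    | hx a ha =>
      have := dia_Y_X 1 a
      rw [one_mul, dia_one_left] at this
      rw [mul_assoc, theta_X_mul, theta_X_mul, this]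
      noncomm_ring
  have h2 : ∀ v, theta (p * (Z + Y) * Y) (v * X) = theta (p * (Z + Y) * Y) v * X +
      rop (theta (p * Y) (v * X) - theta (p * Y) v * X) + theta (p * Y) v * X * Y := by
    intro v
    induction v using left_induction with
    | h1 =>
      simp only [one_mul, theta_X, theta_one_right, map_mul, const_Y, mul_zero, map_zero,
        zero_mul, sub_zero, zero_add, add_zero]
      rw [← mul_assoc X p Y, rop_mul_Y]
      noncomm_ring
    | hadd a b ha hb =>
      have e : theta (p * Y) ((a + b) * X) - theta (p * Y) (a + b) * X =
          (theta (p * Y) (a * X) - theta (p * Y) a * X) +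
          (theta (p * Y) (b * X) - theta (p * Y) b * X) := by
        simp only [add_mul, map_add]
        abel
      rw [e, map_add, add_mul, map_add, ha, hb]
      simp only [map_add, add_mul]
      abel
    | hsmul c a ha =>
      simp only [smul_mul_assoc, map_smul, ha, ← smul_sub, smul_add]
    | hz a ha =>
      obtain ⟨u, hu⟩ := theta_diff_ends (F := p * Y) ⟨0, p, by simp⟩ a
      rw [hu, rop_mul_Y] at ha
      have h3 : theta (p * Y) (Z * a * X) - theta (p * Y) (Z * a) * X = Z * u * Y := by
        rw [mul_assoc, theta_Z_mul, theta_Z_mul, mul_assoc, mul_assoc, ← hu, mul_sub]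
      rw [h3, rop_mul_Y, mul_assoc Z a X, theta_Z_mul, theta_Z_mul, theta_Z_mul, ha]
      noncomm_ring
    | hx a ha =>
      have h3 : theta (p * Y) (X * a * X) - theta (p * Y) (X * a) * X =
          X * dia p (a * X) * Y := by
        rw [mul_assoc, theta_X_mul, theta_X_mul, dia_Y_X]
        noncomm_ring
      rw [h3, rop_mul_Y, mul_assoc X a X, theta_X_mul, theta_X_mul, theta_X_mul, dia_Y_X]
      have h4 : dia (p * (Z + Y)) (a * X) =
          dia p (a * X) * Z + dia p (a * X) * Y + dia (p * Y) a * X := by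
        rw [mul_add, map_add, LinearMap.add_apply, dia_Z_left, dia_Y_X]
        abel
      rw [h4]
      noncomm_ring
  simp only [Algebra.algebraMap_eq_smul_one, map_add, map_smul, rop_one, rop_mul_Y,
    LinearMap.add_apply, LinearMap.smul_apply, h1, h2, theta_one_left, LinearMap.id_apply,
    smul_add, add_mul, smul_mul_assoc, map_sub]
  abel

/-- The word attached to a rooted tree. -/
def treeWord (t : RootedTree) : DiaAlg :=
  ofWords (rop (toWords (t.branches.attach.map (fun s => treeWord s.1)).prod))
termination_by t.deg
decreasing_by exact RootedTree.deg_lt_of_mem_branches s.2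

/-- The multiplicative extension of `treeWord`. -/
def forestWord : HopfTrees →ₐ[ℚ] DiaAlg := MvPolynomial.aeval treeWord

theorem forestWord_graft (m : Multiset RootedTree) :
    toWords (forestWord (MvPolynomial.X (RootedTree.graft m))) =
      rop (toWords (forestWord (forest m))) := by
  rw [forestWord, MvPolynomial.aeval_X, treeWord, toWords_ofWords]
  congr 2
  rw [RootedTree.branches_graft, forest, map_multiset_prod, Multiset.map_map]
  conv_rhs => rw [← Multiset.attach_map_val m, Multiset.map_map]
  simp

theorem forestWord_graftOp (f : HopfTrees) :
    toWords (forestWord (graftOp f)) = rop (toWords (forestWord f)) := by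
  induction f using forest_induction with
  | hf m => rw [graftOp_forest, forestWord_graft]
  | hadd a b ha hb => simp only [map_add, ha, hb]
  | hsmul c a ha => simp only [map_smul, ha]

theorem forestWord_X_ends (t : RootedTree) :
    ∃ u, toWords (forestWord (MvPolynomial.X t)) = u * Y := by
  rw [← RootedTree.graft_branches t, forestWord_graft]
  exact rop_ends _

theorem forestWord_ends {m : Multiset RootedTree} (hm : m ≠ 0) :
    ∃ u, toWords (forestWord (forest m)) = u * Y := by
  induction m using Multiset.induction_on with
  | empty => exact absurd rfl hm
  | cons t m ih =>
    obtain ⟨u, hu⟩ := forestWord_X_ends t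
    rw [forest, Multiset.map_cons, Multiset.prod_cons, map_mul, toWords_mul, hu, ← forest]
    by_cases h : m = 0
    · subst h
      refine ⟨u, ?_⟩
      simp [forest, toWords_one, dia_one_right]
    · obtain ⟨v, hv⟩ := ih h
      rw [hv]
      exact dia_Y_Y_ends u v

theorem forestWord_endsY (f : HopfTrees) : EndsY (toWords (forestWord f)) := by
  induction f using MvPolynomial.induction_on with
  | C c =>
    refine ⟨c, 0, ?_⟩
    rw [← MvPolynomial.algebraMap_eq, AlgHom.commutes, Algebra.algebraMap_eq_smul_one, map_smul,
      toWords_one, Algebra.algebraMap_eq_smul_one, zero_mul, add_zero]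
  | add p q hp hq =>
    obtain ⟨c, u, hu⟩ := hp
    obtain ⟨d, v, hv⟩ := hq
    refine ⟨c + d, u + v, ?_⟩
    rw [map_add, map_add, hu, hv, map_add, add_mul]
    abel
  | mul_X p t hp =>
    obtain ⟨u, hu⟩ := forestWord_X_ends t
    rw [map_mul, toWords_mul, hu]
    exact endsY_dia hp ⟨0, u, by simp⟩

/-- An explicit model of the rooted tree maps. -/
def model : HopfTrees →ₐ[ℚ] Module.End ℚ Words :=
  AlgHom.ofLinearMap (theta ∘ₗ toWords ∘ₗ forestWord.toLinearMap)
    (by simp [toWords_one, theta_one_left]; rfl)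
    (fun a b => by simp [toWords_mul, theta_dia])

theorem model_apply (f : HopfTrees) : model f = theta (toWords (forestWord f)) := rfl

theorem tensorAct_mul (σ τ : HopfTrees ⊗[ℚ] HopfTrees) (s : Words ⊗[ℚ] Words) :
    tensorAct model.toLinearMap (σ * τ) s =
      tensorAct model.toLinearMap σ (tensorAct model.toLinearMap τ s) := by
  induction σ using TensorProduct.induction_on with
  | zero => simp
  | add a b ha hb => simp [add_mul, ha, hb]
  | tmul a b =>
    induction τ using TensorProduct.induction_on with
    | zero => simp
    | add c d hc hd => simp [mul_add, hc, hd]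
    | tmul c d =>
      induction s using TensorProduct.induction_on with
      | zero => simp
      | add c d hc hd => simp only [map_add, hc, hd]
      | tmul v w => simp [tensorAct]

/-- The compatibility of the action of `f` with products of words. -/
def Compatible (f : HopfTrees) : Prop := ∀ v w : Words,
  model f (v * w) =
    LinearMap.mul' ℚ Words (tensorAct model.toLinearMap (coproduct f) (v ⊗ₜ[ℚ] w))

theorem Compatible.apply {f : HopfTrees} (hf : Compatible f) (s : Words ⊗[ℚ] Words) :
    model f (LinearMap.mul' ℚ Words s) =
      LinearMap.mul' ℚ Words (tensorAct model.toLinearMap (coproduct f) s) := by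
  induction s using TensorProduct.induction_on with
  | zero => simp
  | add c d hc hd => simp only [map_add, hc, hd]
  | tmul v w => exact hf v w

theorem Compatible.mul {f g : HopfTrees} (hf : Compatible f) (hg : Compatible g) :
    Compatible (f * g) := by
  intro v w
  rw [map_mul model, Module.End.mul_apply, hg v w, hf.apply, map_mul, tensorAct_mul]

theorem compatible_one : Compatible 1 := by
  intro v w
  rw [map_one, map_one, Algebra.TensorProduct.one_def, tensorAct_tmul]
  simp

theorem compatible_forest {m : Multiset RootedTree}
    (h : ∀ t ∈ m, Compatible (MvPolynomial.X t)) : Compatible (forest m) := by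
  induction m using Multiset.induction_on with
  | empty => simpa [forest] using compatible_one
  | cons t m ih =>
    rw [forest, Multiset.map_cons, Multiset.prod_cons]
    exact (h t (Multiset.mem_cons_self t m)).mul
      (ih fun s hs => h s (Multiset.mem_cons_of_mem hs))

/-- `∑ f̃₁(v) f̃₂(w)` for an element `∑ f₁ ⊗ f₂`. -/
def act (v w : Words) : HopfTrees ⊗[ℚ] HopfTrees →ₗ[ℚ] Words :=
  LinearMap.mul' ℚ Words ∘ₗ LinearMap.applyₗ (v ⊗ₜ[ℚ] w) ∘ₗ tensorAct model.toLinearMap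

theorem act_tmul (v w : Words) (a b : HopfTrees) :
    act v w (a ⊗ₜ[ℚ] b) = model a v * model b w :=
  tensorAct_tmul _ a b v w

theorem act_mul_Z (v w : Words) (τ : HopfTrees ⊗[ℚ] HopfTrees) :
    act v (w * Z) τ = act v w τ * Z := by
  induction τ using TensorProduct.induction_on with
  | zero => simp
  | add a b ha hb => simp [ha, hb, add_mul]
  | tmul a b => rw [act_tmul, act_tmul, model_apply b, theta_mul_Z, mul_assoc]

theorem act_diff_ends (v w : Words) (τ : HopfTrees ⊗[ℚ] HopfTrees) :
    act v (w * X) (graftOp.lTensor HopfTrees τ) =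
      act v w (graftOp.lTensor HopfTrees τ) * X +
        rop (act v (w * X) τ - act v w τ * X) + act v w τ * X * Y := by
  induction τ using TensorProduct.induction_on with
  | zero => simp
  | add a b ha hb =>
    have e : act v (w * X) (a + b) - act v w (a + b) * X =
        (act v (w * X) a - act v w a * X) + (act v (w * X) b - act v w b * X) := by
      simp only [map_add, add_mul]
      abel
    rw [e]
    simp only [map_add, add_mul, ha, hb]
    abel
  | tmul a b =>
    rw [LinearMap.lTensor_tmul]
    simp only [act_tmul, model_apply b, model_apply (graftOp b), forestWord_graftOp]
    rw [theta_rop (forestWord_endsY b) w]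
    obtain ⟨u, hu⟩ := theta_diff_ends (forestWord_endsY b) w
    have e : model a v * theta (toWords (forestWord b)) (w * X) -
        model a v * theta (toWords (forestWord b)) w * X = model a v * u * Y := by
      rw [mul_assoc (model a v) _ X, ← mul_sub, hu, mul_assoc]
    rw [e, hu, rop_mul_Y, rop_mul_Y]
    noncomm_ring

theorem act_one_graft (v : Words) (τ : HopfTrees ⊗[ℚ] HopfTrees) :
    act v 1 (graftOp.lTensor HopfTrees τ) = 0 := by
  induction τ using TensorProduct.induction_on with
  | zero => simp
  | add a b ha hb => simp [ha, hb]
  | tmul a b =>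
    rw [LinearMap.lTensor_tmul, act_tmul, model_apply (graftOp b), forestWord_graftOp,
      theta_one_right]
    obtain ⟨u, hu⟩ := rop_ends (toWords (forestWord b))
    rw [hu, map_mul, const_Y, mul_zero, map_zero, mul_zero]

theorem compatible_tree (t : RootedTree) : Compatible (MvPolynomial.X t) := by
  have hg : Compatible (forest t.branches) :=
    compatible_forest fun s _ => compatible_tree s
  have hg' : ∀ v w, act v w (coproduct (forest t.branches)) = model (forest t.branches) (v * w) :=
    fun v w => (hg v w).symm
  have ht : model (MvPolynomial.X t) = theta (rop (toWords (forestWord (forest t.branches)))) := by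
    rw [← forestWord_graft, RootedTree.graft_branches, model_apply]
  have key : ∀ v w, model (MvPolynomial.X t) (v * w) = model (MvPolynomial.X t) v * w +
      act v w (graftOp.lTensor HopfTrees (coproduct (forest t.branches))) := by
    intro v w
    induction w using right_induction with
    | h1 => rw [act_one_graft, mul_one, mul_one, add_zero]
    | hadd a b ha hb =>
      have e : ∀ τ, act v (a + b) τ = act v a τ + act v b τ := by
        intro τ
        simp [act, TensorProduct.tmul_add]
      rw [e, mul_add, mul_add, map_add, ha, hb]
      abel
    | hsmul c a ha =>
      have e : ∀ τ, act v (c • a) τ = c • act v a τ := by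
        intro τ
        simp [act]
      rw [e, mul_smul_comm, map_smul, ha, smul_add, mul_smul_comm]
    | hz a ha =>
      rw [act_mul_Z, ← mul_assoc, ← mul_assoc, ← add_mul, ← ha, ht, theta_mul_Z]
    | hy a ha =>
      have hz : model (MvPolynomial.X t) (v * (a * Z)) = model (MvPolynomial.X t) v * (a * Z) +
          act v (a * Z) (graftOp.lTensor HopfTrees (coproduct (forest t.branches))) := by
        rw [act_mul_Z, ← mul_assoc, ← mul_assoc, ← add_mul, ← ha, ht, theta_mul_Z]
      have hx : model (MvPolynomial.X t) (v * (a * X)) = model (MvPolynomial.X t) v * (a * X) +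
          act v (a * X) (graftOp.lTensor HopfTrees (coproduct (forest t.branches))) := by
        have h := theta_rop (forestWord_endsY (forest t.branches)) (v * a)
        rw [← ht, ← model_apply] at h
        rw [act_diff_ends, hg', hg', ← mul_assoc v a X, h, ha]
        noncomm_ring
      have e : ∀ τ, act v (a * Y) τ = act v (a * Z) τ - act v (a * X) τ := by
        intro τ
        simp [act, Z, mul_add, TensorProduct.tmul_add]
      have e2 : a * Y = a * Z - a * X := by simp [Z, mul_add]
      rw [e, e2, mul_sub, mul_sub, map_sub, hx, hz]
      abel
  intro v w
  rw [key v w]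
  change _ = act v w _
  conv_rhs => rw [← RootedTree.graft_branches t, coproduct_X_graft, map_add, act_tmul, map_one,
    RootedTree.graft_branches]
  rfl
termination_by t.deg
decreasing_by exact RootedTree.deg_lt_of_mem_branches ‹_›

theorem const_forestWord {m : Multiset RootedTree} (hm : m ≠ 0) :
    const (toWords (forestWord (forest m))) = 0 := by
  obtain ⟨u, hu⟩ := forestWord_ends hm
  rw [hu, map_mul, const_Y, mul_zero]

theorem toWords_dot : toWords (forestWord dot) = Y := by
  rw [dot, forest, Multiset.map_singleton, Multiset.prod_singleton, forestWord_graft]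
  simp [forest, toWords_one, rop_one]

/-- Rooted tree maps exist. -/
theorem isRootedTreeMaps_model : IsRootedTreeMaps model.toLinearMap where
  empty := by simp [forest]; rfl
  dot_x := by
    rw [AlgHom.toLinearMap_apply, model_apply, toWords_dot, theta_X]
  dot_y := by
    rw [AlgHom.toLinearMap_apply, model_apply, toWords_dot, theta_Y const_Y]
  graft m hm := by
    obtain ⟨u, hu⟩ := forestWord_ends hm
    have e : X * (u * (Z + Y) * Y) = X * u * (X + 2 * Y) * Y := by
      rw [Z]
      noncomm_ring
    refine ⟨X * u, ?_, ?_, ?_⟩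
    · rw [AlgHom.toLinearMap_apply, model_apply, theta_X, hu, mul_assoc]
    · rw [AlgHom.toLinearMap_apply, model_apply, theta_X, forestWord_graftOp, hu, rop_mul_Y, e]
    · rw [AlgHom.toLinearMap_apply, model_apply, forestWord_graftOp, hu, rop_mul_Y, theta_Y, e]
      rw [map_mul, const_Y, mul_zero]
  mul_x g h := by simp
  mul_y g h := by simp
  word_x m w _ := compatible_forest (fun t _ => compatible_tree t) w X
  word_y m w _ := compatible_forest (fun t _ => compatible_tree t) w Y

/-- The number of vertices of a forest. -/
def deg (m : Multiset RootedTree) : ℕ := (m.map RootedTree.deg).sum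

theorem deg_add (a b : Multiset RootedTree) : deg (a + b) = deg a + deg b := by simp [deg]

theorem deg_singleton (t : RootedTree) : deg {t} = t.deg := by simp [deg]

theorem deg_tree (t : RootedTree) : t.deg = 1 + deg t.branches := by
  conv_lhs => rw [← RootedTree.graft_branches t, RootedTree.deg_graft]
  rfl

theorem deg_pos {m : Multiset RootedTree} (hm : m ≠ 0) : 0 < deg m := by
  obtain ⟨t, ht⟩ := Multiset.exists_mem_of_ne_zero hm
  obtain ⟨m', rfl⟩ := Multiset.exists_cons_of_mem ht
  rw [← Multiset.singleton_add, deg_add, deg_singleton, deg_tree]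
  omega

theorem forest_add (a b : Multiset RootedTree) : forest (a + b) = forest a * forest b := by
  simp [forest]

theorem forest_zero : forest 0 = 1 := by simp [forest]

theorem forest_singleton (t : RootedTree) : forest {t} = MvPolynomial.X t := by simp [forest]

/-- The span of the tensors of two forests whose degrees satisfy a relation. -/
def degSpan (A : ℕ → ℕ → Prop) : Submodule ℚ (HopfTrees ⊗[ℚ] HopfTrees) :=
  Submodule.span ℚ {τ | ∃ a b, A (deg a) (deg b) ∧ τ = forest a ⊗ₜ[ℚ] forest b}

theorem tmul_mem_degSpan {A : ℕ → ℕ → Prop} {a b : Multiset RootedTree}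
    (h : A (deg a) (deg b)) : forest a ⊗ₜ[ℚ] forest b ∈ degSpan A :=
  Submodule.subset_span ⟨a, b, h, rfl⟩

theorem degSpan_mono {A B : ℕ → ℕ → Prop} (h : ∀ i j, A i j → B i j) : degSpan A ≤ degSpan B :=
  Submodule.span_mono fun _ ⟨a, b, hab, e⟩ => ⟨a, b, h _ _ hab, e⟩

theorem degSpan_mul {A B C : ℕ → ℕ → Prop} (h : ∀ i j k l, A i j → B k l → C (i + k) (j + l))
    {σ τ : HopfTrees ⊗[ℚ] HopfTrees} (hσ : σ ∈ degSpan A) (hτ : τ ∈ degSpan B) :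
    σ * τ ∈ degSpan C := by
  have h1 : degSpan A * degSpan B ≤ degSpan C := by
    rw [degSpan, degSpan, Submodule.span_mul_span, Submodule.span_le]
    rintro _ ⟨_, ⟨a, b, hab, rfl⟩, _, ⟨c, d, hcd, rfl⟩, rfl⟩
    simp only [Algebra.TensorProduct.tmul_mul_tmul, ← forest_add]
    exact tmul_mem_degSpan (by rw [deg_add, deg_add]; exact h _ _ _ _ hab hcd)
  exact h1 (Submodule.mul_mem_mul hσ hτ)

theorem degSpan_graft {A B : ℕ → ℕ → Prop} (h : ∀ i j, A i j → B i (1 + j))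
    {τ : HopfTrees ⊗[ℚ] HopfTrees} (hτ : τ ∈ degSpan A) :
    graftOp.lTensor HopfTrees τ ∈ degSpan B := by
  have h1 : degSpan A ≤ (degSpan B).comap (graftOp.lTensor HopfTrees) := by
    rw [degSpan, Submodule.span_le]
    rintro _ ⟨a, b, hab, rfl⟩
    change graftOp.lTensor HopfTrees (forest a ⊗ₜ[ℚ] forest b) ∈ degSpan B
    rw [LinearMap.lTensor_tmul, graftOp_forest, ← forest_singleton]
    refine tmul_mem_degSpan ?_
    rw [deg_singleton, deg_tree, RootedTree.branches_graft]
    exact h _ _ hab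
  exact h1 hτ

theorem coproduct_forest_sub_mem (m : Multiset RootedTree)
    (h : ∀ t ∈ m, coproduct (MvPolynomial.X t) - MvPolynomial.X t ⊗ₜ[ℚ] 1 ∈
      degSpan (fun i j => i < t.deg ∧ j ≤ t.deg)) :
    coproduct (forest m) - forest m ⊗ₜ[ℚ] 1 ∈ degSpan (fun i j => i < deg m ∧ j ≤ deg m) := by
  induction m using Multiset.induction_on with
  | empty => simp [forest_zero, Algebra.TensorProduct.one_def]
  | cons t m ih =>
    have h1 := h t (Multiset.mem_cons_self t m)
    have h2 := ih fun s hs => h s (Multiset.mem_cons_of_mem hs)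
    rw [← Multiset.singleton_add, forest_add, forest_singleton, map_mul, deg_add, deg_singleton]
    set p := coproduct (MvPolynomial.X t) with hp
    set q := coproduct (forest m) with hq
    have e : p * q - (MvPolynomial.X t * forest m) ⊗ₜ[ℚ] 1 =
        (p - MvPolynomial.X t ⊗ₜ[ℚ] 1) * (forest m ⊗ₜ[ℚ] 1) +
        (p - MvPolynomial.X t ⊗ₜ[ℚ] 1) * (q - forest m ⊗ₜ[ℚ] 1) +
        (MvPolynomial.X t ⊗ₜ[ℚ] 1) * (q - forest m ⊗ₜ[ℚ] 1) := by
      have : (MvPolynomial.X t * forest m) ⊗ₜ[ℚ] (1 : HopfTrees) =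
          (MvPolynomial.X t ⊗ₜ[ℚ] 1) * (forest m ⊗ₜ[ℚ] 1) := by
        rw [Algebra.TensorProduct.tmul_mul_tmul, one_mul]
      rw [this]
      ring
    have h3 : forest m ⊗ₜ[ℚ] (1 : HopfTrees) ∈ degSpan (fun i j => i ≤ deg m ∧ j ≤ deg m) := by
      rw [← forest_zero]
      exact tmul_mem_degSpan (by simp [deg])
    have h4 : MvPolynomial.X t ⊗ₜ[ℚ] (1 : HopfTrees) ∈
        degSpan (fun i j => i ≤ t.deg ∧ j ≤ t.deg) := by
      rw [← forest_zero, ← forest_singleton]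
      exact tmul_mem_degSpan (by simp [deg])
    rw [e]
    refine add_mem (add_mem (degSpan_mul ?_ h1 h3) (degSpan_mul ?_ h1 h2)) (degSpan_mul ?_ h4 h2)
      <;> (intros; omega)

theorem coproduct_tree_sub_mem (t : RootedTree) :
    coproduct (MvPolynomial.X t) - MvPolynomial.X t ⊗ₜ[ℚ] 1 ∈
      degSpan (fun i j => i < t.deg ∧ j ≤ t.deg) := by
  have h := coproduct_forest_sub_mem t.branches fun s _ => coproduct_tree_sub_mem s
  have h2 : forest t.branches ⊗ₜ[ℚ] (1 : HopfTrees) ∈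
      degSpan (fun i j => i ≤ deg t.branches ∧ j ≤ deg t.branches) := by
    rw [← forest_zero]
    exact tmul_mem_degSpan (by simp [deg])
  have h3 := add_mem (degSpan_mono (B := fun i j => i ≤ deg t.branches ∧ j ≤ deg t.branches)
    (fun i j h => ⟨h.1.le, h.2⟩) h) h2
  rw [sub_add_cancel] at h3
  have e := coproduct_X_graft t.branches
  rw [RootedTree.graft_branches] at e
  rw [e, add_sub_cancel_left]
  refine degSpan_graft ?_ h3
  intro i j hij
  rw [deg_tree t]
  omega
termination_by t.deg
decreasing_by exact RootedTree.deg_lt_of_mem_branches ‹_›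

theorem X_ne_zero : X ≠ 0 := FreeAlgebra.ι_ne_zero _

theorem Y_ne_zero : Y ≠ 0 := FreeAlgebra.ι_ne_zero _

/-- The conditions determine the values on letters from the values in smaller degree. -/
theorem letters_unique {ρ ρ' : HopfTrees →ₗ[ℚ] Module.End ℚ Words} (h : IsRootedTreeMaps ρ)
    (h' : IsRootedTreeMaps ρ') (m : Multiset RootedTree)
    (ih : ∀ a, deg a < deg m → ρ (forest a) = ρ' (forest a)) :
    ρ (forest m) X = ρ' (forest m) X ∧ ρ (forest m) Y = ρ' (forest m) Y := by
  induction m using Multiset.induction_on with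
  | empty => rw [h.empty, h'.empty]; exact ⟨rfl, rfl⟩
  | cons t m _ =>
    rw [← Multiset.singleton_add, deg_add, deg_singleton] at ih
    have ht := deg_tree t
    by_cases hm : m = 0
    · subst hm
      have e := graftOp_forest t.branches
      rw [RootedTree.graft_branches, ← forest_singleton] at e
      by_cases hb : t.branches = 0
      · have e2 : forest {t} = dot := by rw [dot, ← hb, RootedTree.graft_branches]
        rw [← Multiset.singleton_add, add_zero, e2, h.dot_x, h'.dot_x, h.dot_y, h'.dot_y]
        exact ⟨rfl, rfl⟩
      · obtain ⟨u, h1, h2, h3⟩ := h.graft _ hb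
        obtain ⟨u', h1', h2', h3'⟩ := h'.graft _ hb
        rw [ih _ (by omega), h1'] at h1
        have hu : u' = u := mul_right_cancel₀ Y_ne_zero h1
        subst hu
        rw [← Multiset.singleton_add, add_zero, ← e, h2, h2', h3, h3']
        exact ⟨rfl, rfl⟩
    · have hd := deg_pos hm
      have i1 := ih {t} (by rw [deg_singleton]; omega)
      have i2 := ih m (by omega)
      rw [← Multiset.singleton_add, forest_add, h.mul_x, h'.mul_x, h.mul_y, h'.mul_y, i1, i2]
      exact ⟨rfl, rfl⟩

theorem act_unique {ρ ρ' : HopfTrees →ₗ[ℚ] Module.End ℚ Words} (n : ℕ)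
    (ih : ∀ a, deg a < n → ρ (forest a) = ρ' (forest a)) (v w : Words)
    (hw : ∀ a, deg a ≤ n → ρ (forest a) w = ρ' (forest a) w)
    {τ : HopfTrees ⊗[ℚ] HopfTrees} (hτ : τ ∈ degSpan (fun i j => i < n ∧ j ≤ n)) :
    LinearMap.mul' ℚ Words (tensorAct ρ τ (v ⊗ₜ[ℚ] w)) =
      LinearMap.mul' ℚ Words (tensorAct ρ' τ (v ⊗ₜ[ℚ] w)) := by
  induction hτ using Submodule.span_induction with
  | mem τ h =>
    obtain ⟨a, b, ⟨h1, h2⟩, rfl⟩ := h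
    rw [tensorAct_tmul, tensorAct_tmul, ih a h1, hw b h2]
  | zero => simp
  | add a b _ _ ha hb => simp only [map_add, LinearMap.add_apply, ha, hb]
  | smul c a _ ha => simp only [map_smul, LinearMap.smul_apply, ha]

theorem forest_unique {ρ ρ' : HopfTrees →ₗ[ℚ] Module.End ℚ Words} (h : IsRootedTreeMaps ρ)
    (h' : IsRootedTreeMaps ρ') (n : ℕ) :
    ∀ m, deg m = n → ρ (forest m) = ρ' (forest m) := by
  induction n using Nat.strong_induction_on with
  | _ n ih =>
    have ih' : ∀ a, deg a < n → ρ (forest a) = ρ' (forest a) := fun a ha => ih _ ha a rfl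
    have hl : ∀ a, deg a ≤ n →
        ρ (forest a) X = ρ' (forest a) X ∧ ρ (forest a) Y = ρ' (forest a) Y :=
      fun a ha => letters_unique h h' a fun b hb => ih' b (by omega)
    intro m hm
    by_cases hm0 : m = 0
    · rw [hm0, h.empty, h'.empty]
    have hs := coproduct_forest_sub_mem m fun t _ => coproduct_tree_sub_mem t
    rw [hm] at hs
    set s := coproduct (forest m) - forest m ⊗ₜ[ℚ] 1 with hs'
    have hc : coproduct (forest m) = forest m ⊗ₜ[ℚ] forest 0 + s := by
      rw [hs', forest_zero]
      abel
    have sx : ∀ w, ρ (forest m) (w * X) = ρ (forest m) w * X +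
        LinearMap.mul' ℚ Words (tensorAct ρ' s (w ⊗ₜ[ℚ] X)) := by
      intro w
      rw [h.word_x m w hm0, hc, map_add, LinearMap.add_apply, map_add, tensorAct_tmul, h.empty,
        act_unique n ih' w X (fun a ha => (hl a ha).1) hs]
      rfl
    have sx' : ∀ w, ρ' (forest m) (w * X) = ρ' (forest m) w * X +
        LinearMap.mul' ℚ Words (tensorAct ρ' s (w ⊗ₜ[ℚ] X)) := by
      intro w
      rw [h'.word_x m w hm0, hc, map_add, LinearMap.add_apply, map_add, tensorAct_tmul, h'.empty]
      rfl
    have sy : ∀ w, ρ (forest m) (w * Y) = ρ (forest m) w * Y +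
        LinearMap.mul' ℚ Words (tensorAct ρ' s (w ⊗ₜ[ℚ] Y)) := by
      intro w
      rw [h.word_y m w hm0, hc, map_add, LinearMap.add_apply, map_add, tensorAct_tmul, h.empty,
        act_unique n ih' w Y (fun a ha => (hl a ha).2) hs]
      rfl
    have sy' : ∀ w, ρ' (forest m) (w * Y) = ρ' (forest m) w * Y +
        LinearMap.mul' ℚ Words (tensorAct ρ' s (w ⊗ₜ[ℚ] Y)) := by
      intro w
      rw [h'.word_y m w hm0, hc, map_add, LinearMap.add_apply, map_add, tensorAct_tmul, h'.empty]
      rfl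
    ext1 w
    induction w using right_induction with
    | h1 =>
      have e := sx 1
      have e' := sx' 1
      rw [one_mul] at e e'
      rw [(hl m hm.le).1, e', add_left_inj] at e
      exact (mul_right_cancel₀ X_ne_zero e).symm
    | hadd a b ha hb => rw [map_add, map_add, ha, hb]
    | hsmul c a ha => rw [map_smul, map_smul, ha]
    | hz a ha => rw [Z, mul_add, map_add, map_add, sx, sx', sy, sy', ha]
    | hy a ha => rw [sy, sy', ha]

/-- There is exactly one assignment `f ↦ f̃` satisfying the defining conditions. -/
theorem existsUnique_isRootedTreeMaps :
    ∃! ρ : HopfTrees →ₗ[ℚ] Module.End ℚ Words, IsRootedTreeMaps ρ := by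
  refine ⟨model.toLinearMap, isRootedTreeMaps_model, fun ρ hρ => ?_⟩
  refine LinearMap.ext fun f => ?_
  induction f using forest_induction with
  | hf m => exact forest_unique hρ isRootedTreeMaps_model _ m rfl
  | hadd a b ha hb => rw [map_add, map_add, ha, hb]
  | hsmul c a ha => rw [map_smul, map_smul, ha]

/-- The assignment `ρ(f) = f̃` of rooted tree maps: the unique linear map satisfying the
defining conditions. -/
def rho : HopfTrees →ₗ[ℚ] Module.End ℚ Words := existsUnique_isRootedTreeMaps.choose

theorem isRootedTreeMaps_rho : IsRootedTreeMaps rho := existsUnique_isRootedTreeMaps.choose_spec.1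

theorem rho_eq_model : rho = model.toLinearMap :=
  existsUnique_isRootedTreeMaps.unique isRootedTreeMaps_rho isRootedTreeMaps_model

end RootedTreeMaps
end

namespace RootedTreeMaps

/-! By `rho_eq_model` and `model_apply`, the map attached to `f` is `theta` of the word `toWords
(forestWord f)`, so it suffices that the word of the relation element vanishes. The word map turns
products of forests into `dia` (written ⋄), B₊ into R = `rop`, and • into y. Hence λ_k becomes R^k 1
and λ_i λ_j becomes P(i,j) = R^i 1 ⋄ R^j 1. With D(i,j) = y ⋄ R P(i,j) - R(y ⋄ P(i,j)), the second
term being omitted at (0,0), the claim is P(m,n) = ∑ R^((m-1-i)+(n-1-j)) D(i,j) over i < m, j < n.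

The heart is `dia_rop_rop`: for words a, b ending in y, Ra ⋄ Rb - R(a ⋄ Rb) - R(Ra ⋄ b) + R²(a ⋄ b)
= y ⋄ R(a ⋄ b) - R(y ⋄ (a ⋄ b)). It rests on the fact that R changes only the right end of such a
word, R(uy) = u(z + y)y, while ⋄ is computed recursively from the right end.

For ladders this says that D is the mixed difference of the array P(i+1,j+1), extended by zero to
negative indices: with shifts S, T in the two indices, D = (1 - RS)(1 - RT) P(·+1,·+1). The boundary
values are checked separately, and the term omitted at (0,0) is exactly what the extension by zero
requires. Inverting each factor by a geometric series in R (`sum_iterate_of_recursion`) recovers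
P(m,n). -/

/-! ### Words of ladders, and the interaction of `rop` with `dia`. -/

theorem rop_ladder_succ (k : ℕ) :
    rop^[k + 1] 1 = (Z + Y) ^ k * Y := by
  induction k with
  | zero => simp [rop_one]
  | succ k ih => rw [Function.iterate_succ_apply', ih, rop_mul_Y, pow_succ]

/-- The commutator of `rop` with the `dia`-multiplication by `y`. -/
theorem dia_Y_rop_sub (u : Words) :
    dia Y (rop (u * Y)) - rop (dia Y (u * Y)) =
      u * (Z * Y + Y * Y - 2 * Y * Z) * Y := by
  -- This is the recursion `dia_Y_Y` with left factor 1 · y; the common last letter is pulled out so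
  -- that `rop_mul_Y` applies to the result.
  have h1 : ∀ w, dia Y (w * Y) = (w * Y + dia Y w - w * Z) * Y := by
    intro w
    have h := dia_Y_Y 1 w
    simp only [one_mul, dia_one_left] at h
    rw [h]
    noncomm_ring
  -- The only product left unexpanded is `dia Y u`. It enters both terms as `dia Y u * (Z + Y) * Y`
  -- and cancels, so the commutator merely replaces the last letter of `u * Y` by a fixed word.
  rw [rop_mul_Y, h1, h1, rop_mul_Y, mul_add u, map_add, dia_Z_right, h1]
  noncomm_ring

/-- The mixed second difference of the `dia`-product with respect to `rop`. -/
theorem dia_rop_rop (u v : Words) :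
    dia (rop (u * Y)) (rop (v * Y)) - rop (dia (u * Y) (rop (v * Y)))
      - rop (dia (rop (u * Y)) (v * Y)) + rop (rop (dia (u * Y) (v * Y))) =
    dia Y (rop (dia (u * Y) (v * Y))) - rop (dia Y (dia (u * Y) (v * Y))) := by
  -- A product of two words ending in y again ends in y; with that letter pulled out, every outer
  -- `rop` can be evaluated by `rop_mul_Y`.
  have h : ∀ a b, dia (a * Y) (b * Y) =
      (dia a (b * Y) + dia (a * Y) b - dia a b * Z) * Y := by
    intro a b
    rw [dia_Y_Y, sub_mul, add_mul]
  have e1 : dia (u * Y) (v * (Z + Y) * Y) =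
      (dia u (v * (Z + Y) * Y) + (dia (u * Y) v * Z + dia (u * Y) (v * Y)) -
        (dia u v * Z + dia u (v * Y)) * Z) * Y := by
    rw [h]
    simp only [mul_add v, map_add, dia_Z_right]
  have e2 : dia (u * (Z + Y) * Y) (v * Y) =
      ((dia u (v * Y) * Z + dia (u * Y) (v * Y)) + dia (u * (Z + Y) * Y) v -
        (dia u v * Z + dia (u * Y) v) * Z) * Y := by
    rw [h]
    simp only [mul_add u, map_add, LinearMap.add_apply, dia_Z_left]
  -- Only the last letters are unfolded. Two of the resulting products are the left sides of `e1`
  -- and `e2`; the products `dia u (v * (Z + Y) * Y)` and `dia (u * (Z + Y) * Y) v` stay as atoms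
  -- and cancel against those from `e1` and `e2`.
  have e3 : dia (u * (Z + Y) * Y) (v * (Z + Y) * Y) =
      ((dia u (v * (Z + Y) * Y) * Z + dia (u * Y) (v * (Z + Y) * Y)) +
        (dia (u * (Z + Y) * Y) v * Z + dia (u * (Z + Y) * Y) (v * Y)) -
        ((dia u v * Z + dia u (v * Y)) * Z +
          (dia (u * Y) v * Z + dia (u * Y) (v * Y))) * Z) * Y := by
    have p : ∀ w, dia (u * (Z + Y)) w = dia u w * Z + dia (u * Y) w := by
      intro w
      rw [mul_add u, map_add, LinearMap.add_apply, dia_Z_left]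
    have q : ∀ w, dia w (v * (Z + Y)) = dia w v * Z + dia w (v * Y) := by
      intro w
      rw [mul_add v, map_add, dia_Z_right]
    rw [h, p, q, p, q, q]
  -- `h u v` is needed twice: first to bring the commutator into the form required by
  -- `dia_Y_rop_sub`, and again because the expansions reintroduce `dia (u * Y) (v * Y)`.
  rw [h u v, dia_Y_rop_sub, rop_mul_Y u, rop_mul_Y v, e3, e1, e2, h u v]
  simp only [rop_mul_Y]
  noncomm_ring

/-! ### Inverting a first difference by a geometric series. -/

/-- Summation of a first order linear recursion. -/
theorem sum_iterate_of_recursion {M : Type*} [AddCommGroup M] (R : M →+ M) (a g : ℕ → M)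
    (h0 : g 0 = a 0) (h : ∀ k, g (k + 1) = a (k + 1) - R (a k)) (n : ℕ) :
    ∑ k ∈ Finset.range (n + 1), R^[n - k] (g k) = a n := by
  induction n with
  | zero => simp [h0]
  | succ n ih =>
    rw [Finset.sum_range_succ, Nat.sub_self, Function.iterate_zero_apply, h]
    have e : ∑ k ∈ Finset.range (n + 1), R^[n + 1 - k] (g k) = R (a n) := by
      rw [← ih, map_sum]
      refine Finset.sum_congr rfl fun k hk => ?_
      -- Since `k ≤ n`, the truncated exponent really grows by one, and one application of `R`
      -- factors out of every summand.
      rw [Nat.succ_sub (Finset.mem_range_succ_iff.1 hk), Function.iterate_succ_apply']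
    rw [e]
    abel

/-! ### The difference equations for products of ladders. -/

/-- The word of a product of two ladders. -/
def ladderProd (i j : ℕ) : Words := dia (rop^[i] 1) (rop^[j] 1)

theorem ladderProd_comm (i j : ℕ) : ladderProd i j = ladderProd j i := dia_comm _ _

theorem ladderProd_zero_left (j : ℕ) : ladderProd 0 j = rop^[j] 1 := dia_one_left _

/-- The commutator of `rop` with the `dia`-multiplication by `y`, at a product of two ladders;
for the empty product the second term is dropped. -/
def ladderDefect (i j : ℕ) : Words :=
  dia Y (rop (ladderProd i j)) -
    if (i, j) ≠ (0, 0) then rop (dia Y (ladderProd i j)) else 0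

theorem ladderDefect_comm (i j : ℕ) : ladderDefect i j = ladderDefect j i := by
  rw [ladderDefect, ladderDefect, ladderProd_comm]
  simp [and_comm]

/-- The corner value. Keeping the second term would leave an extra `- rop Y`, which the extension of
the array by zero does not allow. -/
theorem ladderDefect_zero : ladderDefect 0 0 = ladderProd 1 1 := by
  simp [ladderDefect, ladderProd, rop_one, dia_one_left]

/-- On the edge one factor is the empty ladder, so the product is a single ladder and the commutator
is already a first difference, as y is itself the word of the one-vertex ladder. `dia_rop_rop` does
not cover this case, since the word 1 does not end in y. -/
theorem ladderDefect_zero_succ (j : ℕ) :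
    ladderDefect 0 (j + 1) = ladderProd 1 (j + 2) - rop (ladderProd 1 (j + 1)) := by
  rw [ladderDefect, if_pos (by simp), ladderProd_zero_left, ← Function.iterate_succ_apply' rop]
  simp only [ladderProd, Function.iterate_one, rop_one]

/-- The interior case is `dia_rop_rop` for two nonempty ladders. The bracketing exhibits it as a
first difference in `j` of first differences in `i`, which is the shape needed for summing one index
at a time. -/
theorem ladderDefect_succ_succ (i j : ℕ) :
    ladderDefect (i + 1) (j + 1) = ladderProd (i + 2) (j + 2) - rop (ladderProd (i + 1) (j + 2))
      - rop (ladderProd (i + 2) (j + 1) - rop (ladderProd (i + 1) (j + 1))) := by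
  -- By `rop_ladder_succ` these are the prefixes, before the final y, of the words of the ladders
  -- with `i + 1` and `j + 1` vertices.
  have h := dia_rop_rop ((Z + Y) ^ i) ((Z + Y) ^ j)
  simp only [← rop_ladder_succ, ← Function.iterate_succ_apply' rop] at h
  rw [ladderDefect, if_pos (by simp), map_sub]
  simp only [ladderProd] at h ⊢
  rw [← h]
  abel

/-- Two successive geometric summations: the one over `j` removes the difference in the second index
and leaves a first difference in `i`, which the one over `i` then removes. -/
theorem sum_ladderDefect (m n : ℕ) :
    ∑ i ∈ Finset.range (m + 1), ∑ j ∈ Finset.range (n + 1),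
      rop^[(m - i) + (n - j)] (ladderDefect i j) = ladderProd (m + 1) (n + 1) := by
  have h0 : ∑ j ∈ Finset.range (n + 1), rop^[n - j] (ladderDefect 0 j) = ladderProd 1 (n + 1) :=
    sum_iterate_of_recursion rop.toAddMonoidHom (fun k => ladderProd 1 (k + 1)) _
      ladderDefect_zero ladderDefect_zero_succ n
  have h1 : ∀ i, ∑ j ∈ Finset.range (n + 1), rop^[n - j] (ladderDefect (i + 1) j) =
      ladderProd (i + 2) (n + 1) - rop (ladderProd (i + 1) (n + 1)) := by
    intro i
    refine sum_iterate_of_recursion rop.toAddMonoidHom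
      (fun k => ladderProd (i + 2) (k + 1) - rop (ladderProd (i + 1) (k + 1))) _ ?_
      (fun k => ladderDefect_succ_succ i k) n
    -- The initial value lies on the other edge, `j = 0`, and follows by symmetry from the edge `i =
    -- 0`.
    rw [ladderDefect_comm, ladderDefect_zero_succ, ladderProd_comm 1, ladderProd_comm 1]
  refine Eq.trans ?_ (sum_iterate_of_recursion rop.toAddMonoidHom
    (fun k => ladderProd (k + 1) (n + 1))
    (fun i => ∑ j ∈ Finset.range (n + 1), rop^[n - j] (ladderDefect i j)) h0 h1 m)
  refine Finset.sum_congr rfl fun i _ => ?_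
  change _ = rop^[m - i] _
  -- Iterates are read as powers of a linear map, so that the outer power can be taken out of the
  -- inner sum.
  simp only [← Module.End.coe_pow, map_sum, pow_add, Module.End.mul_apply]

/-! ### The word of the relation element. -/

theorem forestWord_graftOp_iterate (k : ℕ) (f : HopfTrees) :
    toWords (forestWord (graftOp^[k] f)) = rop^[k] (toWords (forestWord f)) := by
  induction k with
  | zero => rfl
  | succ k ih => rw [Function.iterate_succ_apply', forestWord_graftOp, ih,
      Function.iterate_succ_apply']

theorem forestWord_ladder (k : ℕ) : toWords (forestWord (ladder k)) = rop^[k] 1 := by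
  rw [ladder, forestWord_graftOp_iterate, map_one, toWords_one]

theorem forestWord_ladder_mul (i j : ℕ) :
    toWords (forestWord (ladder i * ladder j)) = ladderProd i j := by
  rw [map_mul, toWords_mul, forestWord_ladder, forestWord_ladder, ladderProd]

theorem forestWord_relationElement (m n : ℕ) :
    toWords (forestWord (relationElement (m + 1) (n + 1))) = 0 := by
  -- The two sums of the relation element, at the level of words, merge termwise into the sum of
  -- defects. The exponents differ by one, and this surplus `rop` is the outer one in the second
  -- term of `ladderDefect`.
  have e : ∑ i ∈ Finset.range (m + 1), ∑ j ∈ Finset.range (n + 1),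
        rop^[(m + 1 - i) + (n + 1 - j) - 2] (dia Y (rop (ladderProd i j)))
      - ∑ i ∈ Finset.range (m + 1), ∑ j ∈ Finset.range (n + 1),
        (if (i, j) ≠ (0, 0) then
          rop^[(m + 1 - i) + (n + 1 - j) - 1] (dia Y (ladderProd i j)) else 0) =
      ladderProd (m + 1) (n + 1) := by
    rw [← sum_ladderDefect]
    simp only [← Finset.sum_sub_distrib]
    refine Finset.sum_congr rfl fun i hi => Finset.sum_congr rfl fun j hj => ?_
    rw [Finset.mem_range] at hi hj
    -- No subtraction truncates here, because `i ≤ m` and `j ≤ n`.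
    rw [show (m + 1 - i) + (n + 1 - j) - 2 = (m - i) + (n - j) by omega,
      show (m + 1 - i) + (n + 1 - j) - 1 = (m - i) + (n - j) + 1 by omega, ladderDefect]
    split_ifs
    · simp only [Function.iterate_succ_apply, ← Module.End.coe_pow, map_sub]
    · simp
  -- The sum without the pair (0,0) becomes a full double sum with a conditional, matching the
  -- conditional in `e`.
  rw [relationElement, Finset.sum_filter, Finset.sum_product]
  simp only [map_add, map_sub, map_sum, forestWord_ladder_mul, forestWord_graftOp_iterate]
  rw [← e]
  simp only [map_mul, toWords_mul, toWords_dot, forestWord_graftOp, apply_ite, map_zero,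
    forestWord_graftOp_iterate, forestWord_ladder, mul_assoc, ladderProd]
  abel

end RootedTreeMaps

theorem theorem3p2 (m n : ℕ) (hm : 1 ≤ m) (hn : 1 ≤ n) :
    RootedTreeMaps.rho (RootedTreeMaps.relationElement m n) = 0 := by
  obtain ⟨m, rfl⟩ := Nat.exists_eq_add_of_le' hm
  obtain ⟨n, rfl⟩ := Nat.exists_eq_add_of_le' hn
  rw [RootedTreeMaps.rho_eq_model, AlgHom.toLinearMap_apply, RootedTreeMaps.model_apply,
    RootedTreeMaps.forestWord_relationElement, map_zero]
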